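/- Let $X\subseteq\mathbb{R}^n$ be a compact convex body (compact, convex, with non-empty interior), and let $F:X\to\mathbb{R}^n$ be continuous and pseudomonotone plus on $X$, that is, for all $x,y\in X$: $F(x)^T(y-x)\ge 0$ implies $F(y)^T(y-x)\ge 0$; and $F(x)^T(y-x)\ge 0$ together with $F(y)^T(y-x)=0$ implies $F(x)=F(y)$. For a non-empty compact set $S\subseteq X$ let $g_S(x)=\max_{y\in S}F(x)^T(x-y)$. Let $C_j=\{x: A_jx\le b_j\}$, $j=1,2,\dots$, be polytopes with $C_j\subseteq C_{j+1}$ and $\overline{\bigcup_{j\ge1}C_j}=X$, each full-dimensional in the sense that $A_jx<b_j$ (componentwise) for some $x$. Fix $\varepsilon>0$ and $0\le\eta<1$. An approximate analytic center of a polytope $\{x: Ax\le b\}$ is a point $x$ with slack $s=b-Ax\ge 0$ for which there is a vector $z$ with $A^Tz=0$ and $\|Zs-e\|_2\le\eta$, where $Z=\operatorname{diag}(z)$ and $e=(1,\dots,1)^T$. Consider the following algorithm (Algorithm 2). Start with $j=1$. Step 1. Set $k=0$, $A_j^0=A_j$, $b_j^0=b_j$. Step 2. Find any approximate analytic center $x_j^k$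 of $C_j^k=\{x: A_j^kx\le b_j^k\}$. Step 3. If $g_X(x_j^k)<\varepsilon$, stop with output $x_j^k$. Step 4. Otherwise, if $g_{C_j}(x_j^k)<2^{-j}$, increase $j$ by $1$ and return to Step 1. Step 5. Otherwise obtain $(A_j^{k+1},b_j^{k+1})$ from $(A_j^k,b_j^k)$ by appending the inequality $F(x_j^k)^Tx\le F(x_j^k)^Tx_j^k$, increase $k$ by $1$ and go to Step 2. Then the algorithm stops after a finite number of iterations with an $\varepsilon$-solution of $VI(F,X)$: whatever choices are made in Step 2, an approximate analytic center always exists when Step 2 is reached, no execution is infinite, and the output $x$ satisfies $x\in X$ and $g_X(x)<\varepsilon$. -/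

import Mathlib

namespace ACCPM

/-- `n`-dimensional Euclidean space. -/
abbrev E (n : ℕ) : Type := EuclideanSpace ℝ (Fin n)

/-- A convex body: a convex and bounded subset with non-empty interior. -/
structure IsConvexBody {n : ℕ} (X : Set (E n)) : Prop where
  convex : Convex ℝ X
  bounded : Bornology.IsBounded X
  interior_nonempty : (interior X).Nonempty

/-- `F` is pseudomonotone on `X`. -/
def Pseudomonotone {n : ℕ} (F : E n → E n) (X : Set (E n)) : Prop :=
  ∀ x ∈ X, ∀ y ∈ X, 0 ≤ inner ℝ (F x) (y - x) → 0 ≤ inner ℝ (F y) (y - x)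

/-- `F` is pseudomonotone plus on `X`. -/
def PseudomonotonePlus {n : ℕ} (F : E n → E n) (X : Set (E n)) : Prop :=
  Pseudomonotone F X ∧
    ∀ x ∈ X, ∀ y ∈ X, 0 ≤ inner ℝ (F x) (y - x) → inner ℝ (F y) (y - x) = 0 → F x = F y

/-- The gap function `g_S(x) = max_{y ∈ S} F(x)ᵀ(x - y)`; the supremum is a maximum whenever
`S` is compact and non-empty. -/
noncomputable def gap {n : ℕ} (F : E n → E n) (S : Set (E n)) (x : E n) : ℝ :=
  sSup ((fun y => inner ℝ (F x) (x - y)) '' S)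

/-- `x` is an `ε`-solution of the variational inequality `VI(F, X)`. -/
def IsEpsSolution {n : ℕ} (F : E n → E n) (X : Set (E n)) (ε : ℝ) (x : E n) : Prop :=
  x ∈ X ∧ gap F X x < ε

/-- A finite system of linear inequalities `A x ≤ b` with `m` rows; `row i` is the `i`-th row
of the matrix `A`. -/
structure LinSys (n : ℕ) where
  m : ℕ
  row : Fin m → E n
  rhs : Fin m → ℝ

namespace LinSys

variable {n : ℕ}

/-- The polyhedron `{x | A x ≤ b}`. -/
def feasible (P : LinSys n) : Set (E n) :=
  {x | ∀ i, inner ℝ (P.row i) x ≤ P.rhs i}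

/-- The slack vector `s = b - A x`. -/
noncomputable def slack (P : LinSys n) (x : E n) (i : Fin P.m) : ℝ :=
  P.rhs i - inner ℝ (P.row i) x

/-- The system with the additional last row `vᵀ x ≤ β`. -/
def addRow (P : LinSys n) (v : E n) (β : ℝ) : LinSys n where
  m := P.m + 1
  row := Fin.snoc (α := fun _ => E n) P.row v
  rhs := Fin.snoc (α := fun _ => ℝ) P.rhs β

/-- `x` is an approximate analytic center, with accuracy `η`, of the polyhedron `A x ≤ b`: the
slack `s = b - A x` is nonnegative and there is a dual vector `z` with `Aᵀ z = 0` and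
`‖Z s - e‖ ≤ η` in the Euclidean norm, where `Z = diag z` and `e` is the all-ones vector.
(For `η < 1` this forces `s > 0` and `z > 0`.) -/
def IsApproxCenter (P : LinSys n) (η : ℝ) (x : E n) : Prop :=
  (∀ i, 0 ≤ P.slack x i) ∧
    ∃ z : Fin P.m → ℝ,
      ∑ i, z i • P.row i = 0 ∧
      ‖(WithLp.toLp 2 (fun i => z i * P.slack x i - 1) : EuclideanSpace ℝ (Fin P.m))‖ ≤ η

end LinSys

/-- The systems `C 1, C 2, …` describe an increasing sequence of full-dimensional polytopes
whose union has closure `X`.  Full-dimensionality is expressed through a strictly feasible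
point; for systems without zero rows this says that the polyhedron has non-empty interior.
(`C 0` plays no role.) -/
structure IsPolytopeApproximation {n : ℕ} (C : ℕ → LinSys n) (X : Set (E n)) : Prop where
  strictly_feasible : ∀ j, 1 ≤ j → ∃ x, ∀ i, 0 < (C j).slack x i
  mono : ∀ j, 1 ≤ j → (C j).feasible ⊆ (C (j + 1)).feasible
  closure_eq : closure (⋃ j ∈ Set.Ici 1, (C j).feasible) = X

/-- A configuration of the cutting plane algorithm: either the algorithm is about to start
the iteration with indices `j` and `k`, the current system `A_j^k x ≤ b_j^k` being `P`, or it
has stopped with output `x`. -/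
inductive Config (n : ℕ) : Type where
  | iter (j k : ℕ) (P : LinSys n) : Config n
  | stopped (x : E n) : Config n

/-- One iteration of the analytic center cutting plane algorithm with stopping rule
`g_X(x_j^k) < ε`.  In each case `x` is some approximate analytic center of the current polytope
(any one may be chosen). -/
inductive Step {n : ℕ} (F : E n → E n) (X : Set (E n)) (C : ℕ → LinSys n) (η ε : ℝ) :
    Config n → Config n → Prop where
  /-- The stopping rule holds at `x`: halt with output `x`. -/
  | halt (j k : ℕ) (P : LinSys n) (x : E n) (hx : P.IsApproxCenter η x)
      (hhalt : gap F X x < ε) :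
      Step F X C η ε (.iter j k P) (.stopped x)
  /-- Otherwise, if `g_{C_j}(x) < 1 / 2 ^ j`: restart on the next polytope. -/
  | next (j k : ℕ) (P : LinSys n) (x : E n) (hx : P.IsApproxCenter η x)
      (hhalt : ¬ gap F X x < ε) (hgap : gap F (C j).feasible x < 1 / 2 ^ j) :
      Step F X C η ε (.iter j k P) (.iter (j + 1) 0 (C (j + 1)))
  /-- Otherwise add the cut `F(x)ᵀ y ≤ F(x)ᵀ x` to the current system. -/
  | cut (j k : ℕ) (P : LinSys n) (x : E n) (hx : P.IsApproxCenter η x)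
      (hhalt : ¬ gap F X x < ε) (hgap : ¬ gap F (C j).feasible x < 1 / 2 ^ j) :
      Step F X C η ε (.iter j k P) (.iter j (k + 1) (P.addRow (F x) (inner ℝ (F x) x)))

/-- The initial configuration: `j = 1`, `k = 0`, and the system of the first polytope. -/
def initial {n : ℕ} (C : ℕ → LinSys n) : Config n := .iter 1 0 (C 1)

/-- `c` occurs in some execution of the algorithm. -/
def Reachable {n : ℕ} (F : E n → E n) (X : Set (E n)) (C : ℕ → LinSys n) (η ε : ℝ)
    (c : Config n) : Prop :=
  Relation.ReflTransGen (Step F X C η ε) (initial C) c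

end ACCPM

/-! Each configuration keeps a strictly feasible system: a cut is added only when `gap F X x ≥ ε`,
so its normal `F x` is nonzero and the cut leaves strictly feasible points. A center therefore
exists, namely the maximizer of the slack product.

An infinite execution cannot stay at one `j`. If every cut left a margin `r` at a strictly feasible
`c`, the slack product at `c` would lose at most a factor `r` per cut. But the slack product at `y`
is at most its value at a center times `(1 + T) * exp (-(1 - η) * T)`, where `T` is the norm of the
relative slack changes. The slack of a late cut at `y` is at most a small multiple of `T`, since
bounded normals are eventually small in the dual norm generated by their predecessors. So the
maximal product shrinks by `r / 2` per cut, a contradiction (`LinSys.exists_cut_lt`).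

Hence cuts become arbitrarily shallow near a solution `w` over `C j`, and the corresponding centers
have an accumulation point `y` with `F(y)ᵀ(y - w) ≤ 0`. Pseudomonotonicity plus forces `F y = F w`,
so `y` is a solution and some center has gap below `1 / 2 ^ j` (`exists_gap_lt`).

If instead `j` grows forever, points with gap below `1 / 2 ^ j` over `C j` accumulate at a solution
over the closure `X` of the union, and the stopping test must have succeeded. -/

namespace ACCPM

/-! ### Existence of solutions of pseudomonotone variational inequalities. -/

/-- Berge's intersection theorem: if finitely many closed convex sets cover a compact convex set
and all but any one of them have a common point in it, then all of them do. -/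
theorem exists_mem_forall_of_cover {V ι : Type*} [NormedAddCommGroup V] [NormedSpace ℝ V]
    [DecidableEq ι] (G : ι → Set V) (hGc : ∀ i, IsClosed (G i)) (hG : ∀ i, Convex ℝ (G i))
    (s : Finset ι) :
    ∀ D : Set V, IsCompact D → Convex ℝ D → D.Nonempty → (∀ x ∈ D, ∃ i ∈ s, x ∈ G i) →
      (∀ j ∈ s, ∃ z ∈ D, ∀ i ∈ s, i ≠ j → z ∈ G i) → ∃ z ∈ D, ∀ i ∈ s, z ∈ G i := by
  induction s using Finset.induction_on with
  | empty => intro D _ _ hne _ _; obtain ⟨z, hz⟩ := hne; exact ⟨z, hz, by simp⟩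
  | insert a s ha ih =>
    intro D hDc hD hne hcov hmiss
    by_contra hcon
    push Not at hcon
    have hKc : IsCompact (D ∩ ⋂ i ∈ s, G i) :=
      hDc.inter_right (isClosed_biInter fun i _ => hGc i)
    have hK : Convex ℝ (D ∩ ⋂ i ∈ s, G i) :=
      hD.inter (convex_iInter₂ fun i _ => hG i)
    have hL : Convex ℝ (D ∩ G a) := hD.inter (hG a)
    have hLc : IsClosed (D ∩ G a) := hDc.isClosed.inter (hGc a)
    have hdisj : Disjoint (D ∩ ⋂ i ∈ s, G i) (D ∩ G a) := by
      rw [Set.disjoint_left]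
      rintro x ⟨hxD, hx⟩ ⟨-, hxa⟩
      obtain ⟨i, hi, hxi⟩ := hcon x hxD
      rcases Finset.mem_insert.1 hi with rfl | hi
      · exact hxi hxa
      · exact hxi (Set.mem_iInter₂.1 hx i hi)
    obtain ⟨f, u, v, hfK, huv, hfL⟩ := geometric_hahn_banach_compact_closed hK hKc hL hLc hdisj
    obtain ⟨k, hkD, hk⟩ := hmiss a (Finset.mem_insert_self a s)
    have hk' : ∀ i ∈ s, k ∈ G i := fun i hi =>
      hk i (Finset.mem_insert_of_mem hi) (by rintro rfl; exact ha hi)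
    have hku : f k < u := hfK k ⟨hkD, Set.mem_iInter₂.2 hk'⟩
    -- The segment from `k` to a point of `G a` meets the hyperplane `f = u`. There `G a` is absent,
    -- so the induction hypothesis applies to that slice of `D`; its common point contradicts `f <
    -- u` on the intersection.
    have hcross : ∀ j ∈ s, ∃ z ∈ D ∩ {x | f x = u}, ∀ i ∈ s, i ≠ j → z ∈ G i := by
      intro j hj
      obtain ⟨z, hzD, hz⟩ := hmiss j (Finset.mem_insert_of_mem hj)
      have hza : z ∈ G a := hz a (Finset.mem_insert_self a s) (by rintro rfl; exact ha hj)
      have hzv : v < f z := hfL z ⟨hzD, hza⟩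
      have hd : 0 < f z - f k := by linarith
      set t := (u - f k) / (f z - f k) with ht
      have ht0 : 0 ≤ t := div_nonneg (by linarith) hd.le
      have ht1 : t ≤ 1 := (div_le_one hd).2 (by linarith)
      have htd : t * (f z - f k) = u - f k := div_mul_cancel₀ _ hd.ne'
      refine ⟨(1 - t) • k + t • z, ⟨hD hkD hzD (by linarith) ht0 (by ring), ?_⟩, fun i hi hij =>
        hG i (hk' i hi) (hz i (Finset.mem_insert_of_mem hi) hij) (by linarith) ht0 (by ring)⟩
      simp only [Set.mem_ofPred_eq, map_add, map_smul, smul_eq_mul]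
      linarith
    rcases s.eq_empty_or_nonempty with rfl | ⟨j, hj⟩
    · obtain ⟨i, hi, hki⟩ := hcov k hkD
      obtain rfl : i = a := by simpa using hi
      have := hfL k ⟨hkD, hki⟩
      linarith
    · have hclosed : IsClosed {x | f x = u} := isClosed_eq f.continuous continuous_const
      have hconv : Convex ℝ {x | f x = u} := convex_hyperplane f.toLinearMap.isLinear u
      obtain ⟨z, ⟨hzD, hzu⟩, hz⟩ := ih (D ∩ {x | f x = u}) (hDc.inter_right hclosed)
        (hD.inter hconv) ((hcross j hj).imp fun z hz => hz.1)
        (by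
          rintro x ⟨hxD, hxu⟩
          obtain ⟨i, hi, hxi⟩ := hcov x hxD
          rcases Finset.mem_insert.1 hi with rfl | hi
          · have h1 := hfL x ⟨hxD, hxi⟩
            have h2 : f x = u := hxu
            linarith
          · exact ⟨i, hi, hxi⟩) hcross
      have h1 := hfK z ⟨hzD, Set.mem_iInter₂.2 hz⟩
      have h2 : f z = u := hzu
      linarith

theorem Pseudomonotone.mono {n : ℕ} {F : E n → E n} {X S : Set (E n)} (hF : Pseudomonotone F X)
    (hS : S ⊆ X) : Pseudomonotone F S :=
  fun x hx y hy => hF x (hS hx) y (hS hy)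

/-- The half-spaces `{x | F(y)ᵀ(y - x) ≥ 0}` of a pseudomonotone map have the finite intersection
property. -/
theorem Pseudomonotone.exists_mem_convexHull {n : ℕ} {F : E n → E n} {S : Set (E n)}
    (hF : Pseudomonotone F S) (hS : Convex ℝ S) (m : ℕ) :
    ∀ s : Finset (E n), s.card = m + 1 → (s : Set (E n)) ⊆ S →
      ∃ x ∈ convexHull ℝ (s : Set (E n)), ∀ y ∈ s, 0 ≤ inner ℝ (F y) (y - x) := by
  classical
  induction m with
  | zero =>
    intro s hs _
    obtain ⟨y, rfl⟩ := Finset.card_eq_one.1 hs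
    exact ⟨y, subset_convexHull ℝ _ (by simp), by simp⟩
  | succ m ih =>
    intro s hs hsS
    have hne : s.Nonempty := Finset.card_pos.1 (by omega)
    refine exists_mem_forall_of_cover (fun y : E n => {x : E n | 0 ≤ inner ℝ (F y) (y - x)})
      (fun y => isClosed_le continuous_const (by fun_prop)) ?_ s _
      (Set.Finite.isCompact_convexHull (𝕜 := ℝ) s.finite_toSet) (convex_convexHull ℝ _)
      ((Finset.coe_nonempty.2 hne).convexHull) ?_ ?_
    · intro y x hx z hz a b ha hb hab
      have h : y - (a • x + b • z) = a • (y - x) + b • (y - z) := by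
        rw [← sub_eq_zero]
        have : b = 1 - a := by linarith
        subst this
        module
      simp only [Set.mem_ofPred_eq] at hx hz ⊢
      rw [h, inner_add_right, inner_smul_right, inner_smul_right]
      positivity
    -- If `x` lay in none of the half-spaces, pseudomonotonicity would give `F(x)ᵀ(y - x) < 0` at
    -- every `y ∈ s`, hence at `x`, a point of their hull.
    · intro x hx
      by_contra hcon
      push Not at hcon
      have hxS : x ∈ S := convexHull_min hsS hS hx
      have hneg : (s : Set (E n)) ⊆ {w | inner ℝ (F x) w < inner ℝ (F x) x} := by
        intro y hy
        by_contra hy'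
        refine hcon y hy (hF x hxS y (hsS hy) ?_)
        rw [inner_sub_right]
        simp only [Set.mem_ofPred_eq, not_lt] at hy'
        linarith
      have hconv : Convex ℝ {w | inner ℝ (F x) w < inner ℝ (F x) x} :=
        convex_halfSpace_lt (innerSL ℝ (F x)).toLinearMap.isLinear _
      exact lt_irrefl (inner ℝ (F x) x) (convexHull_min hneg hconv hx)
    · intro j hj
      obtain ⟨x, hx, h⟩ := ih (s.erase j) (by rw [Finset.card_erase_of_mem hj]; omega)
        (fun y hy => hsS (Finset.mem_of_mem_erase hy))
      exact ⟨x, convexHull_mono (Finset.coe_subset.2 (Finset.erase_subset j s)) hx,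
        fun i hi hij => h i (Finset.mem_erase.2 ⟨hij, hi⟩)⟩

/-- A pseudomonotone variational inequality over a compact convex set has a solution. -/
theorem Pseudomonotone.exists_solution {n : ℕ} {F : E n → E n} {S : Set (E n)}
    (hF : Pseudomonotone F S) (hS : Convex ℝ S) (hSc : IsCompact S) (hne : S.Nonempty)
    (hFc : ContinuousOn F S) :
    ∃ x ∈ S, ∀ y ∈ S, 0 ≤ inner ℝ (F x) (y - x) := by
  classical
  obtain ⟨x, hxS, hx⟩ : (S ∩ ⋂ y : S, {x | 0 ≤ inner ℝ (F y) (y - x)}).Nonempty := by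
    refine hSc.inter_iInter_nonempty _
      (fun y => isClosed_le continuous_const (by fun_prop)) fun u => ?_
    rcases u.eq_empty_or_nonempty with rfl | hu
    · simpa using hne
    · have hsub : ((u.image Subtype.val : Finset (E n)) : Set (E n)) ⊆ S := by
        intro y hy
        obtain ⟨z, -, rfl⟩ := Finset.mem_image.1 (Finset.mem_coe.1 hy)
        exact z.2
      obtain ⟨x, hx, h⟩ := hF.exists_mem_convexHull hS _ (u.image Subtype.val)
        (Nat.succ_pred_eq_of_pos (Finset.card_pos.2 (hu.image _))).symm hsub
      exact ⟨x, convexHull_min hsub hS hx, Set.mem_iInter₂.2 fun y hy =>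
        h y (Finset.mem_image_of_mem _ hy)⟩
  refine ⟨x, hxS, fun y hy => ?_⟩
  -- Minty's argument: test with `x + t • (y - x)`, divide by `t`, and let `t` tend to zero.
  have hmem : ∀ t ∈ Set.Ioc (0 : ℝ) 1, x + t • (y - x) ∈ S := fun t ht =>
    hS.add_smul_sub_mem hxS hy ⟨ht.1.le, ht.2⟩
  have hlim : Filter.Tendsto (fun t : ℝ => x + t • (y - x)) (nhdsWithin 0 (Set.Ioc 0 1))
      (nhdsWithin x S) := by
    refine tendsto_nhdsWithin_iff.2 ⟨?_, Filter.eventually_of_mem self_mem_nhdsWithin hmem⟩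
    have h : Continuous fun t : ℝ => x + t • (y - x) := by fun_prop
    have := (h.tendsto 0).mono_left (nhdsWithin_le_nhds (s := Set.Ioc (0 : ℝ) 1))
    simpa using this
  have hlim' : Filter.Tendsto (fun t : ℝ => inner ℝ (F (x + t • (y - x))) (y - x))
      (nhdsWithin 0 (Set.Ioc 0 1)) (nhds (inner ℝ (F x) (y - x))) :=
    ((hFc x hxS).tendsto.comp hlim).inner tendsto_const_nhds
  have : (nhdsWithin (0 : ℝ) (Set.Ioc 0 1)).NeBot := by
    rw [nhdsWithin_Ioc_eq_nhdsGT zero_lt_one]; infer_instance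
  refine ge_of_tendsto hlim' (Filter.eventually_of_mem self_mem_nhdsWithin fun t ht => ?_)
  have h : 0 ≤ inner ℝ (F (x + t • (y - x))) (x + t • (y - x) - x) :=
    Set.mem_iInter.1 hx ⟨_, hmem t ht⟩
  rw [add_sub_cancel_left, inner_smul_right] at h
  exact nonneg_of_mul_nonneg_right h ht.1

/-! ### Scalar estimates for the logarithmic barrier. -/

/-- The self-concordance estimate in one variable. -/
theorem sq_mul_sub_log_le {c T : ℝ} (hc : c ≤ 1) (hT : 0 ≤ T) (hcT : 0 < 1 + c * T) :
    c ^ 2 * (T - Real.log (1 + T)) ≤ c * T - Real.log (1 + c * T) := by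
  have hpos : ∀ t ∈ Set.Icc 0 T, 0 < 1 + c * t := by
    intro t ht
    rcases le_total 0 c with h | h
    · have := mul_nonneg h ht.1
      linarith
    · nlinarith [ht.2]
  have hder : ∀ t ∈ Set.Icc 0 T, HasDerivAt
      (fun t => (c * t - Real.log (1 + c * t)) - c ^ 2 * (t - Real.log (1 + t)))
      ((c * 1 - (c * 1) / (1 + c * t)) - c ^ 2 * (1 - 1 / (1 + t))) t := by
    intro t ht
    have h1 : HasDerivAt (fun t : ℝ => 1 + c * t) (c * 1) t :=
      ((hasDerivAt_id t).const_mul c).const_add 1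
    have h2 : HasDerivAt (fun t : ℝ => 1 + t) 1 t := (hasDerivAt_id t).const_add 1
    exact (((hasDerivAt_id t).const_mul c).sub (h1.log (hpos t ht).ne')).sub
      (((hasDerivAt_id t).sub (h2.log (by linarith [ht.1]))).const_mul _)
  have hmono : MonotoneOn
      (fun t => (c * t - Real.log (1 + c * t)) - c ^ 2 * (t - Real.log (1 + t)))
      (Set.Icc 0 T) := by
    refine monotoneOn_of_deriv_nonneg (convex_Icc 0 T)
      (fun t ht => (hder t ht).continuousAt.continuousWithinAt)
      (fun t ht => (hder t (interior_subset ht)).differentiableAt.differentiableWithinAt) ?_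
    intro t ht
    have ht' := interior_subset ht
    rw [(hder t ht').deriv]
    have h1 := hpos t ht'
    have h2 : 0 < 1 + t := by linarith [ht'.1]
    have h3 : (c * 1 - (c * 1) / (1 + c * t)) - c ^ 2 * (1 - 1 / (1 + t)) =
        c ^ 2 * t ^ 2 * (1 - c) / ((1 + c * t) * (1 + t)) := by
      field_simp
      ring
    rw [h3]
    have : 0 ≤ 1 - c := by linarith
    positivity
  have h := hmono (Set.left_mem_Icc.2 hT) (Set.right_mem_Icc.2 hT) hT
  simp at h
  linarith

/-- The self-concordance estimate: `∑ (τᵢ - log (1 + τᵢ)) ≥ ‖τ‖ - log (1 + ‖τ‖)`. -/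
theorem sub_log_le_sum {ι : Type*} [Fintype ι] {τ : ι → ℝ} {T : ℝ} (hT : 0 ≤ T)
    (hτT : ∑ i, τ i ^ 2 = T ^ 2) (hτ : ∀ i, 0 < 1 + τ i) :
    T - Real.log (1 + T) ≤ ∑ i, (τ i - Real.log (1 + τ i)) := by
  rcases hT.eq_or_lt with rfl | hT
  · simp only [add_zero, Real.log_one, sub_zero]
    refine Finset.sum_nonneg fun i _ => ?_
    linarith [Real.log_le_sub_one_of_pos (hτ i)]
  -- The one-variable estimate with `c = τ i / T ≤ 1`; the squares of these ratios sum to one.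
  · have h : ∀ i, (τ i / T) ^ 2 * (T - Real.log (1 + T)) ≤ τ i - Real.log (1 + τ i) := by
      intro i
      have hi : τ i ^ 2 ≤ T ^ 2 := by
        rw [← hτT]
        exact Finset.single_le_sum (f := fun i => τ i ^ 2) (fun _ _ => sq_nonneg _)
          (Finset.mem_univ i)
      have h1 : τ i / T * T = τ i := div_mul_cancel₀ _ hT.ne'
      have := sq_mul_sub_log_le (c := τ i / T) ((div_le_one hT).2 (abs_le_of_sq_le_sq' hi hT.le).2)
        hT.le (by rw [h1]; exact hτ i)
      rwa [h1] at this
    calc T - Real.log (1 + T) = ∑ i, (τ i / T) ^ 2 * (T - Real.log (1 + T)) := by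
          rw [← Finset.sum_mul]
          simp only [div_pow]
          rw [← Finset.sum_div, hτT, div_self (by positivity), one_mul]
      _ ≤ _ := Finset.sum_le_sum fun i _ => h i

/-- The constants make the linear and quadratic terms of `exp (α * T)` dominate `T` and `T ^ 2`. The
extra factor `T` comes from the slack of the new cut. -/
theorem mul_one_add_mul_exp_le {α T : ℝ} (hα : 0 < α) (hT : 0 ≤ T) :
    T * ((1 + T) * Real.exp (-(α * T))) ≤ 1 / α + 2 / α ^ 2 := by
  have h1 := Real.quadratic_le_exp_of_nonneg (mul_nonneg hα.le hT)
  rw [Real.exp_neg, ← mul_assoc, ← div_eq_mul_inv, div_le_iff₀ (Real.exp_pos _)]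
  have h2 : 0 ≤ 1 / α + 2 / α ^ 2 := by positivity
  refine le_trans ?_ (mul_le_mul_of_nonneg_left h1 h2)
  have h3 : (1 / α + 2 / α ^ 2) * (1 + α * T + (α * T) ^ 2 / 2) =
      T + T ^ 2 + (1 / α + 2 / α ^ 2 + α * T ^ 2 / 2 + 2 * T / α) := by
    field_simp
    ring
  rw [h3]
  have : 0 ≤ 1 / α + 2 / α ^ 2 + α * T ^ 2 / 2 + 2 * T / α := by positivity
  nlinarith

/-! ### Accumulation of bounded normals. -/

/-- A bounded sequence of vectors is eventually small in the dual norm of the quadratic form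
which its previous members generate. -/
theorem eventually_inner_sq_le {V : Type*} [NormedAddCommGroup V] [InnerProductSpace ℝ V]
    [FiniteDimensional ℝ V] {a : ℕ → V} {A : ℝ} (ha : ∀ k, ‖a k‖ ≤ A) {c θ : ℝ} (hc : 0 < c)
    (hθ : 0 < θ) :
    ∀ᶠ k in Filter.atTop, ∀ h : V,
      inner ℝ (a k) h ^ 2 ≤ θ * (c * ‖h‖ ^ 2 + ∑ i ∈ Finset.range k, inner ℝ (a i) h ^ 2) := by
  by_contra hcon
  rw [Filter.not_eventually] at hcon
  obtain ⟨φ, hφ, hφP⟩ := Filter.extraction_of_frequently_atTop hcon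
  obtain ⟨b, -, ψ, hψ, hlim⟩ := tendsto_subseq_of_bounded (x := a ∘ φ)
    (Metric.isBounded_closedBall (x := (0 : V)) (r := A))
    (fun k => mem_closedBall_zero_iff.2 (ha _))
  set χ := φ ∘ ψ with hχ
  have hχm : StrictMono χ := hφ.comp hψ
  have hcauchy : CauchySeq (fun l => a (χ l)) := hlim.cauchySeq
  -- With this `δ` a violation forces `|⟨a, h⟩| ≥ 2 * δ * ‖h‖`, so every earlier vector within `δ`
  -- still contributes `δ ^ 2 * ‖h‖ ^ 2`. `N` such vectors outweigh the bound `A ^ 2 * ‖h‖ ^ 2`.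
  obtain ⟨δ, hδ, hδ2⟩ : ∃ δ > 0, δ ^ 2 = θ * c / 4 :=
    ⟨√(θ * c / 4), by positivity, Real.sq_sqrt (by positivity)⟩
  obtain ⟨L, hL⟩ := Metric.cauchySeq_iff.1 hcauchy δ hδ
  obtain ⟨N, hN⟩ := exists_nat_gt (A ^ 2 / (θ * δ ^ 2))
  have hviol := hφP (ψ (L + N))
  push Not at hviol
  obtain ⟨h, hh⟩ := hviol
  change θ * (c * ‖h‖ ^ 2 + ∑ i ∈ Finset.range (χ (L + N)), inner ℝ (a i) h ^ 2) <
    inner ℝ (a (χ (L + N))) h ^ 2 at hh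
  have hsum0 : 0 ≤ ∑ i ∈ Finset.range (χ (L + N)), inner ℝ (a i) h ^ 2 :=
    Finset.sum_nonneg fun _ _ => sq_nonneg _
  have hlarge : 2 * δ * ‖h‖ ≤ |inner ℝ (a (χ (L + N))) h| := by
    rw [← sq_le_sq₀ (by positivity) (abs_nonneg _), sq_abs]
    have h1 : (2 * δ * ‖h‖) ^ 2 = θ * (c * ‖h‖ ^ 2) := by
      rw [mul_pow, mul_pow, hδ2]
      ring
    have h2 := mul_nonneg hθ.le hsum0
    linarith
  have hprev : ∀ l ∈ Finset.range N, δ ^ 2 * ‖h‖ ^ 2 ≤ inner ℝ (a (χ (L + l))) h ^ 2 := by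
    intro l hl
    have h1 : |inner ℝ (a (χ (L + N)) - a (χ (L + l))) h| ≤ δ * ‖h‖ := by
      refine (abs_real_inner_le_norm _ _).trans ?_
      gcongr
      rw [← dist_eq_norm]
      exact (hL _ (by omega) _ (by omega)).le
    rw [inner_sub_left] at h1
    have h2 := abs_sub_abs_le_abs_sub (inner ℝ (a (χ (L + N))) h) (inner ℝ (a (χ (L + l))) h)
    rw [← mul_pow, ← sq_abs (inner ℝ (a (χ (L + l))) h)]
    gcongr
    linarith
  have hsum : N * (δ ^ 2 * ‖h‖ ^ 2) ≤
      ∑ i ∈ Finset.range (χ (L + N)), inner ℝ (a i) h ^ 2 := by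
    calc N * (δ ^ 2 * ‖h‖ ^ 2) = ∑ l ∈ Finset.range N, δ ^ 2 * ‖h‖ ^ 2 := by simp
      _ ≤ ∑ l ∈ Finset.range N, inner ℝ (a (χ (L + l))) h ^ 2 := Finset.sum_le_sum hprev
      _ = ∑ i ∈ (Finset.range N).image (fun l => χ (L + l)), inner ℝ (a i) h ^ 2 := by
          rw [Finset.sum_image]
          intro l _ l' _ hll
          have := hχm.injective hll
          omega
      _ ≤ _ := by
          refine Finset.sum_le_sum_of_subset_of_nonneg ?_ fun _ _ _ => sq_nonneg _
          intro i hi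
          obtain ⟨l, hl, rfl⟩ := Finset.mem_image.1 hi
          exact Finset.mem_range.2 (hχm (by have := Finset.mem_range.1 hl; omega))
  have hup : inner ℝ (a (χ (L + N))) h ^ 2 ≤ A ^ 2 * ‖h‖ ^ 2 := by
    rw [← mul_pow, ← sq_abs]
    gcongr
    exact (abs_real_inner_le_norm _ _).trans (by gcongr; exact ha _)
  rw [div_lt_iff₀ (by positivity)] at hN
  have h1 : A ^ 2 * ‖h‖ ^ 2 ≤ N * (θ * δ ^ 2) * ‖h‖ ^ 2 := by gcongr
  have h2 : θ * (N * (δ ^ 2 * ‖h‖ ^ 2)) ≤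
      θ * ∑ i ∈ Finset.range (χ (L + N)), inner ℝ (a i) h ^ 2 := by gcongr
  have h3 : 0 ≤ θ * (c * ‖h‖ ^ 2) := by positivity
  linarith

/-! ### Approximate analytic centers and central cuts. -/

namespace LinSys

variable {n : ℕ}

/-- The product of the slacks, the exponential of the negative logarithmic barrier. -/
noncomputable def slackProd (P : LinSys n) (x : E n) : ℝ := ∏ i, P.slack x i

/-- The quadratic form `‖A h‖²`. -/
noncomputable def quad (P : LinSys n) (h : E n) : ℝ := ∑ i, inner ℝ (P.row i) h ^ 2

theorem mem_feasible_iff {P : LinSys n} {x : E n} : x ∈ P.feasible ↔ ∀ i, 0 ≤ P.slack x i := by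
  simp [feasible, slack]

theorem slack_sub (P : LinSys n) (x y : E n) (i : Fin P.m) :
    P.slack y i - P.slack x i = inner ℝ (P.row i) (x - y) := by
  simp [slack, inner_sub_right]

theorem continuous_slack (P : LinSys n) (i : Fin P.m) : Continuous fun x => P.slack x i := by
  unfold slack
  fun_prop

theorem isClosed_feasible (P : LinSys n) : IsClosed P.feasible := by
  simp only [feasible, Set.ofPred_forall]
  exact isClosed_iInter fun i => isClosed_le (by fun_prop) continuous_const

theorem convex_feasible (P : LinSys n) : Convex ℝ P.feasible := by
  simp only [feasible, Set.ofPred_forall]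
  exact convex_iInter fun i =>
    convex_halfSpace_le (innerSL ℝ (P.row i)).toLinearMap.isLinear _

theorem forall_slack_addRow (P : LinSys n) (v : E n) (β : ℝ) (x : E n) (p : ℝ → Prop) :
    (∀ i, p ((P.addRow v β).slack x i)) ↔ (∀ i, p (P.slack x i)) ∧ p (β - inner ℝ v x) := by
  change (∀ i : Fin (P.m + 1), p ((P.addRow v β).slack x i)) ↔ _
  rw [Fin.forall_fin_succ']
  simp [slack, addRow]

theorem slackProd_addRow (P : LinSys n) (v : E n) (β : ℝ) (x : E n) :
    (P.addRow v β).slackProd x = P.slackProd x * (β - inner ℝ v x) := by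
  refine (Fin.prod_univ_castSucc (n := P.m) fun i => (P.addRow v β).slack x i).trans ?_
  simp [slackProd, slack, addRow]

theorem quad_addRow (P : LinSys n) (v : E n) (β : ℝ) (h : E n) :
    (P.addRow v β).quad h = P.quad h + inner ℝ v h ^ 2 := by
  change ∑ i : Fin (P.m + 1), inner ℝ ((P.addRow v β).row i) h ^ 2 = _
  rw [Fin.sum_univ_castSucc]
  simp [quad, addRow]

theorem feasible_addRow_subset (P : LinSys n) (v : E n) (β : ℝ) :
    (P.addRow v β).feasible ⊆ P.feasible := by
  intro x hx
  rw [mem_feasible_iff] at hx ⊢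
  exact ((P.forall_slack_addRow v β x (0 ≤ ·)).1 hx).1

theorem slackProd_pos {P : LinSys n} {x : E n} (hx : ∀ i, 0 < P.slack x i) : 0 < P.slackProd x :=
  Finset.prod_pos fun i _ => hx i

/-- At an approximate center with `η < 1` all products `zᵢ sᵢ` are positive. -/
theorem IsApproxCenter.slack_pos {P : LinSys n} {η : ℝ} {x : E n} (hx : P.IsApproxCenter η x)
    (hη : η < 1) (i : Fin P.m) : 0 < P.slack x i := by
  obtain ⟨h0, z, -, hz⟩ := hx
  refine (h0 i).lt_of_ne fun h => ?_
  have := (PiLp.norm_apply_le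
    (WithLp.toLp 2 (fun i => z i * P.slack x i - 1) : EuclideanSpace ℝ (Fin P.m)) i).trans hz
  simp [← h] at this
  linarith

/-- A bounded polyhedron with a strictly feasible point has an analytic center. -/
theorem exists_isApproxCenter {P : LinSys n} (hb : Bornology.IsBounded P.feasible)
    (hs : ∃ x, ∀ i, 0 < P.slack x i) {η : ℝ} (hη : 0 ≤ η) : ∃ x, P.IsApproxCenter η x := by
  obtain ⟨c, hc⟩ := hs
  have hcont : Continuous P.slackProd :=
    continuous_finsetProd _ fun i _ => P.continuous_slack i
  obtain ⟨x, hxP, hmax⟩ := (Metric.isCompact_of_isClosed_isBounded P.isClosed_feasible hb).exists_isMaxOn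
    ⟨c, mem_feasible_iff.2 fun i => (hc i).le⟩ hcont.continuousOn
  have hx0 := mem_feasible_iff.1 hxP
  have hprod : 0 < P.slackProd x :=
    (slackProd_pos hc).trans_le (hmax (mem_feasible_iff.2 fun i => (hc i).le))
  have hx : ∀ i, 0 < P.slack x i := fun i => (hx0 i).lt_of_ne fun h =>
    hprod.ne' (Finset.prod_eq_zero (Finset.mem_univ i) h.symm)
  -- The first-order condition at the maximizer says `Aᵀ z = 0` for `z = 1 / s`, an exact center.
  have hcrit : ∀ h : E n, ∑ i, inner ℝ (P.row i) h / P.slack x i = 0 := by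
    intro h
    have hs : ∀ i (t : ℝ), P.slack (x + t • h) i = P.slack x i - t * inner ℝ (P.row i) h := by
      intro i t
      simp [slack, inner_add_right, inner_smul_right]
      ring
    have hder : HasDerivAt (fun t : ℝ => ∑ i, Real.log (P.slack x i - t * inner ℝ (P.row i) h))
        (∑ i, -(1 * inner ℝ (P.row i) h) / (P.slack x i - 0 * inner ℝ (P.row i) h)) 0 := by
      refine HasDerivAt.fun_sum fun i _ => ?_
      exact (((hasDerivAt_id (0 : ℝ)).mul_const _).const_sub _).log (by simpa using (hx i).ne')
    have hloc : IsLocalMax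
        (fun t : ℝ => ∑ i, Real.log (P.slack x i - t * inner ℝ (P.row i) h)) 0 := by
      have hnear : ∀ᶠ t in nhds (0 : ℝ), ∀ i, 0 < P.slack x i - t * inner ℝ (P.row i) h := by
        rw [Filter.eventually_all]
        intro i
        have hci : Continuous fun t : ℝ => P.slack x i - t * inner ℝ (P.row i) h := by fun_prop
        exact (hci.tendsto 0).eventually_const_lt (by simpa using hx i)
      filter_upwards [hnear] with t ht
      have ht' : ∀ i, 0 < P.slack (x + t • h) i := fun i => by rw [hs]; exact ht i
      have hle := hmax (mem_feasible_iff.2 fun i => (ht' i).le)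
      have := Real.log_le_log (slackProd_pos ht') hle
      unfold slackProd at this
      rw [Real.log_prod fun i _ => (ht' i).ne', Real.log_prod fun i _ => (hx i).ne'] at this
      simp only [hs] at this
      simpa using this
    have := hloc.hasDerivAt_eq_zero hder
    simpa [neg_div] using this
  refine ⟨x, hx0, fun i => (P.slack x i)⁻¹, ?_, ?_⟩
  · rw [← inner_self_eq_zero (𝕜 := ℝ), sum_inner, ← hcrit (∑ i, (P.slack x i)⁻¹ • P.row i)]
    refine Finset.sum_congr rfl fun i _ => ?_
    rw [inner_smul_left, div_eq_inv_mul]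
    rfl
  · have : (fun i => (P.slack x i)⁻¹ * P.slack x i - 1) = 0 := by
      funext i
      simp [inv_mul_cancel₀ (hx i).ne']
    rw [this]
    simpa using hη

/-- The barrier at any strictly feasible point, compared with its value at an approximate
center. -/
theorem IsApproxCenter.slackProd_le {P : LinSys n} {η : ℝ} {x y : E n}
    (hx : P.IsApproxCenter η x) (hη : η < 1) (hy : ∀ i, 0 < P.slack y i) {T : ℝ} (hT : 0 ≤ T)
    (hxy : ∑ i, (inner ℝ (P.row i) (x - y) / P.slack x i) ^ 2 = T ^ 2) :
    P.slackProd y ≤ P.slackProd x * ((1 + T) * Real.exp (-((1 - η) * T))) := by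
  have hpos := hx.slack_pos hη
  obtain ⟨-, z, hz0, hz⟩ := hx
  set τ : Fin P.m → ℝ := fun i => inner ℝ (P.row i) (x - y) / P.slack x i with hτ
  have hratio : ∀ i, 1 + τ i = P.slack y i / P.slack x i := by
    intro i
    simp only [hτ, ← P.slack_sub x y i]
    rw [sub_div, div_self (hpos i).ne']
    ring
  have hτpos : ∀ i, 0 < 1 + τ i := fun i => by rw [hratio]; exact div_pos (hy i) (hpos i)
  have horth : ∑ i, z i * P.slack x i * τ i = 0 := by
    have h : ∑ i, z i * P.slack x i * τ i = inner ℝ (∑ i, z i • P.row i) (x - y) := by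
      rw [sum_inner]
      refine Finset.sum_congr rfl fun i _ => ?_
      rw [inner_smul_left, mul_assoc, mul_div_cancel₀ _ (hpos i).ne']
      rfl
    rw [h, hz0, inner_zero_left]
  -- As `Z s` is orthogonal to `τ`, the sum is `-⟨Z s - e, τ⟩`; apply Cauchy–Schwarz.
  have hsum : ∑ i, τ i ≤ η * T := by
    have hcs := abs_real_inner_le_norm
      (WithLp.toLp 2 (fun i => z i * P.slack x i - 1) : EuclideanSpace ℝ (Fin P.m))
      (WithLp.toLp 2 τ)
    have hnorm : ‖(WithLp.toLp 2 τ : EuclideanSpace ℝ (Fin P.m))‖ = T := by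
      rw [EuclideanSpace.norm_eq]
      simp only [Real.norm_eq_abs, sq_abs]
      rw [hxy, Real.sqrt_sq hT]
    have hinner : inner ℝ
        (WithLp.toLp 2 (fun i => z i * P.slack x i - 1) : EuclideanSpace ℝ (Fin P.m))
        (WithLp.toLp 2 τ) = -∑ i, τ i := by
      simp only [PiLp.inner_apply, RCLike.inner_apply, conj_trivial]
      rw [← sub_eq_zero, ← horth, sub_neg_eq_add, ← Finset.sum_add_distrib]
      refine Finset.sum_congr rfl fun i _ => ?_
      ring
    rw [hinner, abs_neg, hnorm] at hcs
    exact (le_abs_self _).trans (hcs.trans (mul_le_mul_of_nonneg_right hz hT))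
  have hlog := sub_log_le_sum hT hxy hτpos
  rw [Finset.sum_sub_distrib] at hlog
  have hprod : P.slackProd y = P.slackProd x * ∏ i, (1 + τ i) := by
    simp only [slackProd, ← Finset.prod_mul_distrib, hratio]
    exact Finset.prod_congr rfl fun i _ => (mul_div_cancel₀ _ (hpos i).ne').symm
  rw [hprod]
  refine mul_le_mul_of_nonneg_left ?_ (slackProd_pos hpos).le
  have h1T : 0 < 1 + T := by linarith
  rw [← Real.log_le_log_iff (Finset.prod_pos fun i _ => hτpos i) (by positivity),
    Real.log_prod fun i _ => (hτpos i).ne', Real.log_mul h1T.ne' (Real.exp_pos _).ne',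
    Real.log_exp]
  linarith

/-- A cut through an approximate center which is shallow in the quadratic norm of the system
reduces the maximal slack product by a large factor. -/
theorem IsApproxCenter.slackProd_mul_le {P : LinSys n} {η D θ : ℝ} {x y v : E n}
    (hx : P.IsApproxCenter η x) (hη : η < 1) (hy : ∀ i, 0 < P.slack y i) (hD : 0 < D)
    (hxD : ∀ i, P.slack x i ≤ D) (hθ : 0 ≤ θ)
    (hv : inner ℝ v (x - y) ^ 2 ≤ θ ^ 2 * P.quad (x - y)) :
    P.slackProd y * inner ℝ v (x - y) ≤
      P.slackProd x * (θ * D * (1 / (1 - η) + 2 / (1 - η) ^ 2)) := by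
  have hpos := hx.slack_pos hη
  set T := √(∑ i, (inner ℝ (P.row i) (x - y) / P.slack x i) ^ 2) with hT
  have hT0 : 0 ≤ T := Real.sqrt_nonneg _
  have hT2 : ∑ i, (inner ℝ (P.row i) (x - y) / P.slack x i) ^ 2 = T ^ 2 :=
    (Real.sq_sqrt (Finset.sum_nonneg fun _ _ => sq_nonneg _)).symm
  have hquad : P.quad (x - y) ≤ D ^ 2 * T ^ 2 := by
    rw [← hT2, quad, Finset.mul_sum]
    refine Finset.sum_le_sum fun i _ => ?_
    rw [div_pow, mul_div_assoc', le_div_iff₀ (pow_pos (hpos i) 2), mul_comm]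
    gcongr
    · exact (hpos i).le
    · exact hxD i
  have hvT : inner ℝ v (x - y) ≤ θ * D * T := by
    refine (abs_le_of_sq_le_sq' (hv.trans ?_) (by positivity)).2
    rw [mul_pow, mul_pow, mul_assoc]
    gcongr
  have h1 := hx.slackProd_le hη hy hT0 hT2
  have h2 := mul_one_add_mul_exp_le (sub_pos.2 hη) hT0
  have hx0 := (slackProd_pos hpos).le
  calc P.slackProd y * inner ℝ v (x - y) ≤ P.slackProd y * (θ * D * T) :=
        mul_le_mul_of_nonneg_left hvT (slackProd_pos hy).le
    _ ≤ P.slackProd x * ((1 + T) * Real.exp (-((1 - η) * T))) * (θ * D * T) :=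
        mul_le_mul_of_nonneg_right h1 (by positivity)
    _ = P.slackProd x * (θ * D * (T * ((1 + T) * Real.exp (-((1 - η) * T))))) := by ring
    _ ≤ _ := by gcongr

/-- The rows of a bounded feasible system span the space. -/
theorem exists_quad_ge {P : LinSys n} (hb : Bornology.IsBounded P.feasible)
    (hne : P.feasible.Nonempty) : ∃ c > 0, ∀ h, c * ‖h‖ ^ 2 ≤ P.quad h := by
  have hinj : ∀ h : E n, P.quad h = 0 → h = 0 := by
    intro h hh
    obtain ⟨x, hx⟩ := hne
    obtain ⟨R, hR⟩ := hb.exists_norm_le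
    have hrow : ∀ i, inner ℝ (P.row i) h = 0 := fun i => by
      simpa using (Finset.sum_eq_zero_iff_of_nonneg fun _ _ => sq_nonneg _).1 hh i
        (Finset.mem_univ i)
    by_contra hne
    have hpos : 0 < ‖h‖ := norm_pos_iff.2 hne
    have hR0 : 0 ≤ R := (norm_nonneg _).trans (hR x hx)
    -- A null direction of the form never leaves the polyhedron; a step of length `2 * R + 1`
    -- exceeds its diameter.
    have hmem : x + ((2 * R + 1) / ‖h‖) • h ∈ P.feasible := fun i => by
      rw [inner_add_right, inner_smul_right, hrow, mul_zero, add_zero]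
      exact hx i
    have h1 := norm_sub_le (x + ((2 * R + 1) / ‖h‖) • h) x
    rw [add_sub_cancel_left, norm_smul, Real.norm_of_nonneg (by positivity),
      div_mul_cancel₀ _ hpos.ne'] at h1
    linarith [hR _ hx, hR _ hmem]
  have hcont : Continuous P.quad := by
    unfold quad
    fun_prop
  rcases (Metric.sphere (0 : E n) 1).eq_empty_or_nonempty with hS | hS
  · refine ⟨1, one_pos, fun h => ?_⟩
    have h0 : h = 0 := by
      by_contra hh
      have : ‖h‖⁻¹ • h ∈ Metric.sphere (0 : E n) 1 := by
        simp [norm_smul, inv_mul_cancel₀ (norm_ne_zero_iff.2 hh)]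
      rw [hS] at this
      exact this
    simp [h0, quad]
  · obtain ⟨u, hu, hmin⟩ := (isCompact_sphere (0 : E n) 1).exists_isMinOn hS hcont.continuousOn
    have hu1 : ‖u‖ = 1 := by simpa using hu
    refine ⟨P.quad u, (Finset.sum_nonneg fun _ _ => sq_nonneg _).lt_of_ne fun h => ?_, fun h => ?_⟩
    · rw [hinj u h.symm] at hu1
      simp at hu1
    · rcases eq_or_ne h 0 with rfl | hh
      · simp [quad]
      · have hn := norm_ne_zero_iff.2 hh
        have hmem : ‖h‖⁻¹ • h ∈ Metric.sphere (0 : E n) 1 := by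
          simp [norm_smul, inv_mul_cancel₀ hn]
        have h1 : P.quad u ≤ P.quad (‖h‖⁻¹ • h) := hmin hmem
        have h2 : P.quad h = ‖h‖ ^ 2 * P.quad (‖h‖⁻¹ • h) := by
          simp only [quad, inner_smul_right, mul_pow, ← Finset.mul_sum]
          field_simp
        rw [h2, mul_comm]
        gcongr

/-- Central cuts through approximate analytic centers of a bounded polytope cannot all leave a
uniform margin at a strictly feasible point. -/
theorem exists_cut_lt {P : ℕ → LinSys n} {a x : ℕ → E n} {η A r : ℝ} {c : E n} (hη : η < 1)
    (hP : ∀ k, P (k + 1) = (P k).addRow (a k) (inner ℝ (a k) (x k)))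
    (hx : ∀ k, (P k).IsApproxCenter η (x k)) (hb : Bornology.IsBounded (P 0).feasible)
    (ha : ∀ k, ‖a k‖ ≤ A) (hc : ∀ i, 0 < (P 0).slack c i) (hr : 0 < r) :
    ∃ k, inner ℝ (a k) (x k - c) < r := by
  by_contra! hcon
  have hcP : c ∈ (P 0).feasible := mem_feasible_iff.2 fun i => (hc i).le
  have hsub : ∀ k, (P k).feasible ⊆ (P 0).feasible := by
    intro k
    induction k with
    | zero => exact subset_rfl
    | succ k ih =>
      rw [hP]
      exact (feasible_addRow_subset _ _ _).trans ih
  have hxP : ∀ k, x k ∈ (P 0).feasible := fun k => hsub k (mem_feasible_iff.2 (hx k).1)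
  have hA : 0 ≤ A := (norm_nonneg _).trans (ha 0)
  obtain ⟨R, hR⟩ := hb.exists_norm_le
  have hR0 : 0 ≤ R := (norm_nonneg _).trans (hR c hcP)
  -- One bound serves every stage: original slacks are bounded by `B`, those of the cuts by `A * (R
  -- + R)`.
  obtain ⟨D, hD, hslack⟩ : ∃ D > 0, ∀ k, ∀ y ∈ (P 0).feasible, ∀ i, (P k).slack y i ≤ D := by
    have hB : ∀ i, ‖(P 0).rhs i‖ + ‖(P 0).row i‖ * R ≤
        ∑ i, (‖(P 0).rhs i‖ + ‖(P 0).row i‖ * R) := fun i =>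
      Finset.single_le_sum (f := fun i => ‖(P 0).rhs i‖ + ‖(P 0).row i‖ * R)
        (fun _ _ => by positivity) (Finset.mem_univ i)
    set B := ∑ i, (‖(P 0).rhs i‖ + ‖(P 0).row i‖ * R) with hBdef
    have hB0 : 0 ≤ B := Finset.sum_nonneg fun _ _ => by positivity
    refine ⟨B + A * (R + R) + 1, by positivity, fun k => ?_⟩
    have hAR : 0 ≤ A * (R + R) := by positivity
    induction k with
    | zero =>
      intro y hy i
      have h1 : -inner ℝ ((P 0).row i) y ≤ ‖(P 0).row i‖ * R :=
        (neg_le_abs _).trans ((abs_real_inner_le_norm _ _).trans (by gcongr; exact hR y hy))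
      have h2 : (P 0).rhs i ≤ ‖(P 0).rhs i‖ := Real.le_norm_self _
      have h3 := hB i
      unfold slack
      linarith
    | succ k ih =>
      intro y hy
      rw [hP]
      refine (forall_slack_addRow _ _ _ _ (· ≤ _)).2 ⟨ih y hy, ?_⟩
      rw [← inner_sub_right]
      have h1 : inner ℝ (a k) (x k - y) ≤ A * (R + R) :=
        (real_inner_le_norm _ _).trans (mul_le_mul (ha k)
          ((norm_sub_le _ _).trans (add_le_add (hR _ (hxP k)) (hR y hy))) (norm_nonneg _) hA)
      linarith
  obtain ⟨κ, hκ, hquad0⟩ := exists_quad_ge hb ⟨c, hcP⟩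
  have hquad : ∀ k h, (P k).quad h = (P 0).quad h + ∑ i ∈ Finset.range k, inner ℝ (a i) h ^ 2 := by
    intro k h
    induction k with
    | zero => simp
    | succ k ih => rw [hP, quad_addRow, ih, Finset.sum_range_succ, add_assoc]
  have hM : 0 < 1 / (1 - η) + 2 / (1 - η) ^ 2 := by
    have := sub_pos.2 hη
    positivity
  set M := 1 / (1 - η) + 2 / (1 - η) ^ 2 with hMdef
  -- Chosen so that the reduction factor `θ * D * M` equals `r / 2`.
  set θ := r / 2 / (D * M) with hθ
  have hθ0 : 0 < θ := by positivity
  obtain ⟨K, hK⟩ := Filter.eventually_atTop.1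
    (eventually_inner_sq_le ha hκ (pow_pos hθ0 2))
  have hstep : ∀ k ≥ K, ∀ y, (∀ i, 0 < (P k).slack y i) →
      (P (k + 1)).slackProd y ≤ (P k).slackProd (x k) * (r / 2) := by
    intro k hk y hy
    rw [hP, slackProd_addRow, ← inner_sub_right]
    have hv : inner ℝ (a k) (x k - y) ^ 2 ≤ θ ^ 2 * (P k).quad (x k - y) := by
      refine (hK k hk _).trans ?_
      rw [hquad]
      gcongr
      exact hquad0 _
    have h := (hx k).slackProd_mul_le hη hy hD (hslack k _ (hxP k)) hθ0.le hv
    rwa [show θ * D * M = r / 2 by rw [hθ]; field_simp] at h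
  have hpos_mono : ∀ k y, (∀ i, 0 < (P (k + 1)).slack y i) → ∀ i, 0 < (P k).slack y i := by
    intro k y hy
    rw [hP] at hy
    exact ((forall_slack_addRow _ _ _ _ (0 < ·)).1 hy).1
  have hupper : ∀ j y, (∀ i, 0 < (P (K + j)).slack y i) →
      (P (K + j)).slackProd y ≤ D ^ (P K).m * (r / 2) ^ j := by
    intro j
    induction j with
    | zero =>
      intro y hy
      have hyP : y ∈ (P 0).feasible := hsub K (mem_feasible_iff.2 fun i => (hy i).le)
      calc (P K).slackProd y ≤ ∏ _i : Fin (P K).m, D :=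
            Finset.prod_le_prod (fun i _ => (hy i).le) fun i _ => hslack K y hyP i
        _ = _ := by simp
    | succ j ih =>
      intro y hy
      refine (hstep (K + j) (by omega) y (hpos_mono _ y hy)).trans ?_
      rw [pow_succ, ← mul_assoc]
      gcongr
      -- The induction hypothesis is used at the center, not at `y`.
      exact ih _ ((hx (K + j)).slack_pos hη)
  have hcpos : ∀ k, ∀ i, 0 < (P k).slack c i := by
    intro k
    induction k with
    | zero => exact hc
    | succ k ih =>
      rw [hP]
      refine (forall_slack_addRow _ _ _ _ (0 < ·)).2 ⟨ih, ?_⟩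
      rw [← inner_sub_right]
      exact hr.trans_le (hcon k)
  have hlower : ∀ j, (P K).slackProd c * r ^ j ≤ (P (K + j)).slackProd c := by
    intro j
    induction j with
    | zero => simp
    | succ j ih =>
      rw [← add_assoc, hP, slackProd_addRow, ← inner_sub_right, pow_succ, ← mul_assoc]
      exact mul_le_mul ih (hcon _) hr.le (slackProd_pos (hcpos _)).le
  have hKc := slackProd_pos (hcpos K)
  obtain ⟨j, hj⟩ := pow_unbounded_of_one_lt (D ^ (P K).m / (P K).slackProd c) one_lt_two
  have h := (hlower j).trans (hupper j c (hcpos _))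
  rw [div_lt_iff₀ hKc] at hj
  rw [div_pow, mul_div_assoc', le_div_iff₀ (by positivity)] at h
  have hrj : 0 < r ^ j := pow_pos hr j
  nlinarith

end LinSys

/-! ### Shallow cuts, limits and small gaps. -/

variable {n : ℕ}

/-- If `x̄` satisfies the variational inequality over `S`, the gap is small along every sequence
that tends to `x̄`. -/
theorem eventually_gap_lt {F : E n → E n} {X S : Set (E n)} (hFc : ContinuousOn F X)
    (hS : Bornology.IsBounded S) {u : ℕ → E n} {x : E n} (hu : ∀ l, u l ∈ X) (hx : x ∈ X)
    (hlim : Filter.Tendsto u Filter.atTop (nhds x))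
    (hsol : ∀ y ∈ S, inner ℝ (F x) (x - y) ≤ 0) {δ : ℝ} (hδ : 0 < δ) :
    ∀ᶠ l in Filter.atTop, gap F S (u l) < δ := by
  obtain ⟨R, hR⟩ := hS.exists_norm_le
  have hF : Filter.Tendsto (fun l => F (u l)) Filter.atTop (nhds (F x)) :=
    (hFc x hx).tendsto.comp
      (tendsto_nhdsWithin_iff.2 ⟨hlim, Filter.Eventually.of_forall hu⟩)
  have herr : Filter.Tendsto
      (fun l => inner ℝ (F (u l)) (u l - x) + ‖F (u l) - F x‖ * (‖x‖ + R)) Filter.atTop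
      (nhds 0) := by
    have h1 := hF.inner (𝕜 := ℝ) (hlim.sub_const x)
    have h2 := ((hF.sub_const (F x)).norm).mul_const (‖x‖ + R)
    simpa using h1.add h2
  filter_upwards [herr.eventually_lt_const (half_pos hδ)] with l hl
  -- A supremum inherits only a non-strict bound, hence `δ / 2`.
  refine lt_of_le_of_lt (Real.sSup_le ?_ (half_pos hδ).le) (half_lt_self hδ)
  rintro _ ⟨y, hy, rfl⟩
  have h1 : inner ℝ (F (u l) - F x) (x - y) ≤ ‖F (u l) - F x‖ * (‖x‖ + R) :=
    (real_inner_le_norm _ _).trans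
      (by gcongr; exact (norm_sub_le _ _).trans (by gcongr; exact hR y hy))
  have h2 : inner ℝ (F (u l)) (u l - y) =
      inner ℝ (F (u l)) (u l - x) + inner ℝ (F (u l) - F x) (x - y) + inner ℝ (F x) (x - y) := by
    simp only [inner_sub_left, inner_sub_right]
    ring
  have h3 := hsol y hy
  simp only at hl ⊢
  linarith

theorem PseudomonotonePlus.mono {F : E n → E n} {X S : Set (E n)} (hF : PseudomonotonePlus F X)
    (hS : S ⊆ X) : PseudomonotonePlus F S :=
  ⟨hF.1.mono hS, fun x hx y hy => hF.2 x (hS hx) y (hS hy)⟩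

/-- Cutting a bounded polytope through approximate analytic centers brings the gap below every
positive tolerance. -/
theorem exists_gap_lt {F : E n → E n} {P : ℕ → LinSys n} {x : ℕ → E n} {η δ : ℝ} (hη : η < 1)
    (hP : ∀ k, P (k + 1) = (P k).addRow (F (x k)) (inner ℝ (F (x k)) (x k)))
    (hx : ∀ k, (P k).IsApproxCenter η (x k)) (hb : Bornology.IsBounded (P 0).feasible)
    (hs : ∃ c, ∀ i, 0 < (P 0).slack c i) (hFc : ContinuousOn F (P 0).feasible)
    (hF : PseudomonotonePlus F (P 0).feasible) (hδ : 0 < δ) :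
    ∃ k, gap F (P 0).feasible (x k) < δ := by
  obtain ⟨c, hc⟩ := hs
  set S := (P 0).feasible with hS
  have hSc : IsCompact S := Metric.isCompact_of_isClosed_isBounded (P 0).isClosed_feasible hb
  have hcS : c ∈ S := LinSys.mem_feasible_iff.2 fun i => (hc i).le
  have hsub : ∀ k, (P k).feasible ⊆ S := by
    intro k
    induction k with
    | zero => exact subset_rfl
    | succ k ih =>
      rw [hP]
      exact (LinSys.feasible_addRow_subset _ _ _).trans ih
  have hxS : ∀ k, x k ∈ S := fun k => hsub k (LinSys.mem_feasible_iff.2 (hx k).1)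
  obtain ⟨w, hwS, hw⟩ := hF.1.exists_solution (P 0).convex_feasible hSc ⟨c, hcS⟩ hFc
  obtain ⟨A, hA⟩ := (hSc.image_of_continuousOn hFc).isBounded.exists_norm_le
  -- The solution `w` may lie on the boundary, so it is approached by strictly feasible points, with
  -- margins tending to zero.
  have hshallow : ∀ l : ℕ, ∃ k, inner ℝ (F (x k)) (x k - (w + (1 / ((l : ℝ) + 1)) • (c - w))) <
      1 / ((l : ℝ) + 1) := by
    intro l
    have ht0 : 0 < 1 / ((l : ℝ) + 1) := Nat.one_div_pos_of_nat
    have ht1 : 1 / ((l : ℝ) + 1) ≤ 1 := by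
      rw [div_le_one (by positivity)]
      linarith [(Nat.cast_nonneg l : (0 : ℝ) ≤ l)]
    refine LinSys.exists_cut_lt (A := A) hη hP hx hb
      (fun k => hA _ (Set.mem_image_of_mem F (hxS k))) (fun i => ?_) ht0
    have h1 := LinSys.mem_feasible_iff.1 hwS i
    have h2 : (P 0).slack (w + (1 / ((l : ℝ) + 1)) • (c - w)) i =
        (1 - 1 / ((l : ℝ) + 1)) * (P 0).slack w i + 1 / ((l : ℝ) + 1) * (P 0).slack c i := by
      simp only [LinSys.slack, inner_add_right, inner_smul_right, inner_sub_right]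
      ring
    rw [h2]
    exact add_pos_of_nonneg_of_pos (mul_nonneg (by linarith) h1) (mul_pos ht0 (hc i))
  choose κ hκ using hshallow
  obtain ⟨y, hyS, φ, hφ, hlim⟩ := hSc.tendsto_subseq (x := fun l => x (κ l)) fun l => hxS _
  have hFlim : Filter.Tendsto (fun l => F (x (κ (φ l)))) Filter.atTop (nhds (F y)) :=
    (hFc y hyS).tendsto.comp
      (tendsto_nhdsWithin_iff.2 ⟨hlim, Filter.Eventually.of_forall fun l => hxS _⟩)
  have ht : Filter.Tendsto (fun l => 1 / ((φ l : ℝ) + 1)) Filter.atTop (nhds 0) :=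
    (tendsto_one_div_add_atTop_nhds_zero_nat (𝕜 := ℝ)).comp hφ.tendsto_atTop
  have hle : inner ℝ (F y) (y - w) ≤ 0 := by
    have h1 : Filter.Tendsto
        (fun l => x (κ (φ l)) - (w + (1 / ((φ l : ℝ) + 1)) • (c - w))) Filter.atTop
        (nhds (y - (w + (0 : ℝ) • (c - w)))) :=
      hlim.sub ((ht.smul_const (c - w)).const_add w)
    have h2 := le_of_tendsto_of_tendsto' (hFlim.inner (𝕜 := ℝ) h1) ht fun l => (hκ (φ l)).le
    simpa using h2
  have hge : 0 ≤ inner ℝ (F y) (y - w) := hF.1 w hwS y hyS (hw y hyS)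
  have heq : F w = F y := hF.2 w hwS y hyS (hw y hyS) (le_antisymm hle hge)
  have hsol : ∀ v ∈ S, inner ℝ (F y) (y - v) ≤ 0 := by
    intro v hv
    have h1 := hw v hv
    rw [heq, inner_sub_right] at h1
    rw [inner_sub_right] at hle ⊢
    linarith
  obtain ⟨l, hl⟩ := (eventually_gap_lt hFc hb (fun l => hxS _) hyS hlim hsol hδ).exists
  exact ⟨_, hl⟩

namespace IsPolytopeApproximation

variable {C : ℕ → LinSys n} {X : Set (E n)}

theorem feasible_subset (hC : IsPolytopeApproximation C X) {j : ℕ} (hj : 1 ≤ j) :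
    (C j).feasible ⊆ X := by
  rw [← hC.closure_eq]
  exact (Set.subset_biUnion_of_mem (u := fun j => (C j).feasible) (Set.mem_Ici.2 hj)).trans
    subset_closure

theorem feasible_mono (hC : IsPolytopeApproximation C X) {i j : ℕ} (hi : 1 ≤ i) (hij : i ≤ j) :
    (C i).feasible ⊆ (C j).feasible := by
  induction j, hij using Nat.le_induction with
  | base => exact subset_rfl
  | succ j hij ih => exact ih.trans (hC.mono j (hi.trans hij))

end IsPolytopeApproximation

/-- Approximate solutions over the polytopes `C j`, with tolerances tending to zero, are
approximate solutions over `X` for some `j`. -/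
theorem exists_gap_lt_of_approximation {F : E n → E n} {X : Set (E n)} (hXc : IsCompact X)
    (hFc : ContinuousOn F X) {C : ℕ → LinSys n} (hC : IsPolytopeApproximation C X) {x : ℕ → E n}
    (hxX : ∀ j, x j ∈ X)
    (hx : ∀ j, 1 ≤ j → gap F (C j).feasible (x j) < 1 / 2 ^ j) {ε : ℝ} (hε : 0 < ε) :
    ∃ j, 1 ≤ j ∧ gap F X (x j) < ε := by
  obtain ⟨y, hyX, φ, hφ, hlim⟩ := hXc.tendsto_subseq hxX
  have hFlim : Filter.Tendsto (fun l => F (x (φ l))) Filter.atTop (nhds (F y)) :=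
    (hFc y hyX).tendsto.comp
      (tendsto_nhdsWithin_iff.2 ⟨hlim, Filter.Eventually.of_forall fun l => hxX _⟩)
  have hpow : Filter.Tendsto (fun l => (1 : ℝ) / 2 ^ φ l) Filter.atTop (nhds 0) := by
    have h := (tendsto_pow_atTop_nhds_zero_of_lt_one (r := (1 / 2 : ℝ)) (by norm_num)
      (by norm_num)).comp hφ.tendsto_atTop
    simpa [Function.comp_def] using h
  -- By monotonicity `v` lies in all later polytopes, where the gap bounds its inner product by `1 /
  -- 2 ^ φ l`.
  have hunion : ∀ v ∈ ⋃ j ∈ Set.Ici 1, (C j).feasible, inner ℝ (F y) (y - v) ≤ 0 := by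
    intro v hv
    obtain ⟨i, hi, hvi⟩ := Set.mem_iUnion₂.1 hv
    refine le_of_tendsto_of_tendsto (hFlim.inner (𝕜 := ℝ) (hlim.sub_const v)) hpow ?_
    filter_upwards [hφ.tendsto_atTop.eventually_ge_atTop i] with l hl
    have hbdd : BddAbove ((fun w => inner ℝ (F (x (φ l))) (x (φ l) - w)) ''
        (C (φ l)).feasible) := by
      obtain ⟨R, hR⟩ := (hXc.isBounded.subset
        (hC.feasible_subset (j := φ l) (le_trans hi hl))).exists_norm_le
      refine ⟨‖F (x (φ l))‖ * (‖x (φ l)‖ + R), ?_⟩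
      rintro _ ⟨w, hw, rfl⟩
      exact (real_inner_le_norm _ _).trans
        (by gcongr; exact (norm_sub_le _ _).trans (by gcongr; exact hR w hw))
    have h1 := le_csSup hbdd (Set.mem_image_of_mem _ (hC.feasible_mono hi hl hvi))
    exact h1.trans (hx (φ l) (le_trans hi hl)).le
  have hsol : ∀ v ∈ X, inner ℝ (F y) (y - v) ≤ 0 := by
    intro v hv
    rw [← hC.closure_eq] at hv
    have hclosed : IsClosed {v | inner ℝ (F y) (y - v) ≤ 0} :=
      isClosed_le (by fun_prop) continuous_const
    exact closure_minimal hunion hclosed hv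
  obtain ⟨l, hl, hl1⟩ := ((eventually_gap_lt hFc hXc.isBounded (fun l => hxX _) hyX hlim hsol
    hε).and (hφ.tendsto_atTop.eventually_ge_atTop 1)).exists
  exact ⟨φ l, hl1, hl⟩

/-! ### The invariant and the executions of the algorithm. -/

/-- A system which describes a strictly feasible part of `C j`. -/
structure IsSubsystem (C : ℕ → LinSys n) (j : ℕ) (P : LinSys n) : Prop where
  one_le : 1 ≤ j
  subset : P.feasible ⊆ (C j).feasible
  strictly_feasible : ∃ x, ∀ i, 0 < P.slack x i

theorem IsPolytopeApproximation.isSubsystem {C : ℕ → LinSys n} {X : Set (E n)}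
    (hC : IsPolytopeApproximation C X) {j : ℕ} (hj : 1 ≤ j) : IsSubsystem C j (C j) :=
  ⟨hj, subset_rfl, hC.strictly_feasible j hj⟩

/-- The cut passes through `x`; a short move along `-v` makes it strict without violating the other
rows. -/
theorem LinSys.exists_slack_addRow_pos {P : LinSys n} {x v : E n} (hx : ∀ i, 0 < P.slack x i)
    (hv : v ≠ 0) : ∃ y, ∀ i, 0 < (P.addRow v (inner ℝ v x)).slack y i := by
  have hnear : ∀ᶠ t in nhdsWithin (0 : ℝ) (Set.Ioi 0), ∀ i, 0 < P.slack (x - t • v) i := by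
    refine nhdsWithin_le_nhds (Filter.eventually_all.2 fun i => ?_)
    have hci : Continuous fun t : ℝ => P.slack (x - t • v) i :=
      (P.continuous_slack i).comp (by fun_prop)
    exact (hci.tendsto 0).eventually_const_lt (by simpa using hx i)
  obtain ⟨t, ht, ht0⟩ := (hnear.and self_mem_nhdsWithin).exists
  refine ⟨x - t • v, (P.forall_slack_addRow _ _ _ (0 < ·)).2 ⟨ht, ?_⟩⟩
  rw [inner_sub_right, inner_smul_right, sub_sub_cancel]
  exact mul_pos ht0 (real_inner_self_pos.2 hv)

theorem IsSubsystem.addRow {C : ℕ → LinSys n} {j : ℕ} {P : LinSys n} (hP : IsSubsystem C j P)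
    {F : E n → E n} {X : Set (E n)} {η ε : ℝ} (hη : η < 1) (hε : 0 < ε) {x : E n}
    (hx : P.IsApproxCenter η x) (hgap : ¬ gap F X x < ε) :
    IsSubsystem C j (P.addRow (F x) (inner ℝ (F x) x)) := by
  refine ⟨hP.one_le, (LinSys.feasible_addRow_subset _ _ _).trans hP.subset,
    LinSys.exists_slack_addRow_pos (hx.slack_pos hη) fun h => hgap ?_⟩
  refine lt_of_le_of_lt (Real.sSup_le ?_ le_rfl) hε
  rintro _ ⟨y, -, rfl⟩
  simp [h]

/-- The invariant of the algorithm. -/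
def Config.Valid (F : E n → E n) (X : Set (E n)) (C : ℕ → LinSys n) (ε : ℝ) : Config n → Prop
  | .iter j _ P => IsSubsystem C j P
  | .stopped x => IsEpsSolution F X ε x

section Algorithm

variable {F : E n → E n} {X : Set (E n)} {C : ℕ → LinSys n} {η ε : ℝ}

theorem Step.valid (hC : IsPolytopeApproximation C X) (hη : η < 1) (hε : 0 < ε) {c c' : Config n}
    (h : Step F X C η ε c c') (hc : c.Valid F X C ε) : c'.Valid F X C ε := by
  cases h with
  | halt j k P x hx hhalt =>
    exact ⟨hC.feasible_subset hc.one_le (hc.subset (LinSys.mem_feasible_iff.2 hx.1)), hhalt⟩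
  | next j k P x hx hhalt hgap => exact hC.isSubsystem (Nat.le_add_left 1 j)
  | cut j k P x hx hhalt hgap => exact IsSubsystem.addRow hc hη hε hx hhalt

theorem Reachable.valid (hC : IsPolytopeApproximation C X) (hη : η < 1) (hε : 0 < ε)
    {c : Config n} (h : Reachable F X C η ε c) : c.Valid F X C ε := by
  induction h with
  | refl => exact hC.isSubsystem le_rfl
  | tail _ hstep ih => exact hstep.valid hC hη hε ih

theorem exists_step (hXc : IsCompact X) (hC : IsPolytopeApproximation C X) (hη : 0 ≤ η) {j k : ℕ}
    {P : LinSys n} (hP : IsSubsystem C j P) : ∃ c', Step F X C η ε (.iter j k P) c' := by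
  obtain ⟨x, hx⟩ := LinSys.exists_isApproxCenter
    (hXc.isBounded.subset (hP.subset.trans (hC.feasible_subset hP.one_le)))
    hP.strictly_feasible hη
  by_cases h1 : gap F X x < ε
  · exact ⟨_, .halt j k P x hx h1⟩
  · by_cases h2 : gap F (C j).feasible x < 1 / 2 ^ j
    · exact ⟨_, .next j k P x hx h1 h2⟩
    · exact ⟨_, .cut j k P x hx h1 h2⟩

/-- An infinite execution that has reached the polytope `C j` leaves it with a point whose gap over
`C j` is small. -/
theorem exists_next (hXc : IsCompact X) (hFc : ContinuousOn F X) (hF : PseudomonotonePlus F X)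
    (hC : IsPolytopeApproximation C X) (hη : η < 1) {σ : ℕ → Config n}
    (hσ : ∀ t, Step F X C η ε (σ t) (σ (t + 1))) {j : ℕ} (hj : 1 ≤ j) {t : ℕ}
    (ht : σ t = .iter j 0 (C j)) :
    ∃ s k P x, σ s = .iter j k P ∧ P.IsApproxCenter η x ∧ ¬ gap F X x < ε ∧
      gap F (C j).feasible x < 1 / 2 ^ j ∧ σ (s + 1) = .iter (j + 1) 0 (C (j + 1)) := by
  by_contra hcon
  -- Without a restart every later step is a cut: halting is excluded because a stopped
  -- configuration has no successor.
  have hcut : ∀ k P, σ (t + k) = .iter j k P → ∃ x, P.IsApproxCenter η x ∧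
      ¬ gap F (C j).feasible x < 1 / 2 ^ j ∧
      σ (t + k + 1) = .iter j (k + 1) (P.addRow (F x) (inner ℝ (F x) x)) := by
    intro k P hk
    have hstep := hσ (t + k)
    rw [hk] at hstep
    generalize hc : σ (t + k + 1) = c at hstep
    cases hstep with
    | halt _ _ _ x hx hhalt =>
      have h := hσ (t + k + 1)
      rw [hc] at h
      cases h
    | next _ _ _ x hx hhalt hgap => exact absurd ⟨t + k, k, P, x, hk, hx, hhalt, hgap, hc⟩ hcon
    | cut _ _ _ x hx hhalt hgap => exact ⟨x, hx, hgap, rfl⟩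
  have hiter : ∀ k, ∃ P, σ (t + k) = .iter j k P := by
    intro k
    induction k with
    | zero => exact ⟨C j, ht⟩
    | succ k ih =>
      obtain ⟨P, hP⟩ := ih
      obtain ⟨x, -, -, hx⟩ := hcut k P hP
      exact ⟨_, hx⟩
  choose P hP using hiter
  choose x hx hgap hnext using fun k => hcut k (P k) (hP k)
  have hP0 : P 0 = C j := by
    have h := (hP 0).symm.trans ht
    injection h
  have hrec : ∀ k, P (k + 1) = (P k).addRow (F (x k)) (inner ℝ (F (x k)) (x k)) := by
    intro k
    have h := (hP (k + 1)).symm.trans (hnext k)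
    injection h
  have hsub : (P 0).feasible ⊆ X := hP0 ▸ hC.feasible_subset hj
  obtain ⟨k, hk⟩ := exists_gap_lt (δ := 1 / 2 ^ j) hη hrec hx (hXc.isBounded.subset hsub)
    (hP0 ▸ hC.strictly_feasible j hj) (hFc.mono hsub) (hF.mono hsub) (by positivity)
  rw [hP0] at hk
  exact hgap k hk

theorem not_exists_infinite_execution (hXc : IsCompact X) (hFc : ContinuousOn F X)
    (hF : PseudomonotonePlus F X) (hC : IsPolytopeApproximation C X) (hη : η < 1) (hε : 0 < ε) :
    ¬ ∃ σ : ℕ → Config n, σ 0 = initial C ∧ ∀ t, Step F X C η ε (σ t) (σ (t + 1)) := by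
  rintro ⟨σ, hσ0, hσ⟩
  have hreach : ∀ j, ∃ t, σ t = .iter (j + 1) 0 (C (j + 1)) := by
    intro j
    induction j with
    | zero => exact ⟨0, hσ0⟩
    | succ j ih =>
      obtain ⟨t, ht⟩ := ih
      obtain ⟨s, -, -, -, -, -, -, -, hs⟩ :=
        exists_next hXc hFc hF hC hη hσ (Nat.le_add_left 1 j) ht
      exact ⟨s + 1, hs⟩
  have hvalid : ∀ t, (σ t).Valid F X C ε := by
    intro t
    induction t with
    | zero => rw [hσ0]; exact hC.isSubsystem le_rfl
    | succ t ih => exact (hσ t).valid hC hη hε ih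
  have hpoint : ∀ j, ∃ x ∈ X, ¬ gap F X x < ε ∧
      (1 ≤ j → gap F (C j).feasible x < 1 / 2 ^ j) := by
    have hpos : ∀ j, 1 ≤ j → ∃ x ∈ X, ¬ gap F X x < ε ∧
        gap F (C j).feasible x < 1 / 2 ^ j := by
      intro j hj
      obtain ⟨i, rfl⟩ := Nat.exists_eq_add_of_le' hj
      obtain ⟨t, ht⟩ := hreach i
      obtain ⟨s, k, P, x, hs, hx, hhalt, hgap, -⟩ := exists_next hXc hFc hF hC hη hσ hj ht
      have hP : IsSubsystem C (i + 1) P := by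
        have h := hvalid s
        rwa [hs] at h
      exact ⟨x, hC.feasible_subset hj (hP.subset (LinSys.mem_feasible_iff.2 hx.1)), hhalt, hgap⟩
    intro j
    -- Index `0` is a filler, given the point for `j = 1`.
    rcases Nat.eq_zero_or_pos j with rfl | hj
    · obtain ⟨x, hxX, hhalt, -⟩ := hpos 1 le_rfl
      exact ⟨x, hxX, hhalt, fun h => absurd h (by norm_num)⟩
    · obtain ⟨x, hxX, hhalt, hgap⟩ := hpos j hj
      exact ⟨x, hxX, hhalt, fun _ => hgap⟩
  choose x hxX hhalt hgap using hpoint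
  obtain ⟨j, -, hj⟩ := exists_gap_lt_of_approximation hXc hFc hC hxX hgap hε
  exact hhalt j hj

end Algorithm

end ACCPM

/-- For a continuous pseudomonotone plus map on a compact convex body, every execution of the
algorithm can be continued until it stops, every execution is finite, and the point with which
it stops is an `ε`-solution. -/
theorem theorem3 (n : ℕ) (X : Set (ACCPM.E n)) (hX : ACCPM.IsConvexBody X) (hXc : IsCompact X)
    (F : ACCPM.E n → ACCPM.E n) (hFc : ContinuousOn F X) (hF : ACCPM.PseudomonotonePlus F X)
    (C : ℕ → ACCPM.LinSys n) (hC : ACCPM.IsPolytopeApproximation C X)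
    (η : ℝ) (hη0 : 0 ≤ η) (hη1 : η < 1) (ε : ℝ) (hε : 0 < ε) :
    (∀ c, ACCPM.Reachable F X C η ε c →
        (∃ x, c = ACCPM.Config.stopped x) ∨ ∃ c', ACCPM.Step F X C η ε c c') ∧
    (¬ ∃ σ : ℕ → ACCPM.Config n, σ 0 = ACCPM.initial C ∧
        ∀ t, ACCPM.Step F X C η ε (σ t) (σ (t + 1))) ∧
    (∀ x, ACCPM.Reachable F X C η ε (ACCPM.Config.stopped x) →
        ACCPM.IsEpsSolution F X ε x) := by
  refine ⟨fun c hc => ?_, ACCPM.not_exists_infinite_execution hXc hFc hF hC hη1 hε,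
    fun x hx => hx.valid hC hη1 hε⟩
  have hvalid := hc.valid hC hη1 hε
  cases c with
  | stopped x => exact .inl ⟨x, rfl⟩
  | iter j k P => exact .inr (ACCPM.exists_step hXc hC hη0 hvalid)
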